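/- Let $(\Omega,\mathcal F,\mathbb P)$ be a probability space, let $p\in[1,\infty]$, and let $q\in[1,\infty]$ be the conjugate exponent, $\frac1p+\frac1q=1$ (so $q=\infty$ if $p=1$ and $q=1$ if $p=\infty$). For every $\lambda\in[0,1]$ let $\rho_\lambda:L^p\to\mathbb R\cup\{\infty\}$ be a convex monetary risk measure with the Fatou property, where $L^p=L^p(\Omega,\mathcal F,\mathbb P)$; that is, for all $X,X_1,X_2\in L^p$, $m\in\mathbb R$ and $a\in[0,1]$, - $\rho_\lambda(X+m)=\rho_\lambda(X)-m$; - $\rho_\lambda(X_1)\le\rho_\lambda(X_2)$ whenever $X_1\ge X_2$ $\mathbb P$-almost surely; - $\rho_\lambda(aX_1+(1-a)X_2)\le a\rho_\lambda(X_1)+(1-a)\rho_\lambda(X_2)$ (with $0\cdot\infty=0$); - $\rho_\lambda(X)\le\liminf_{n\to\infty}\rho_\lambda(X_n)$ for every sequence $(X_n)\subset L^p$ with $X_n\to X$ $\mathbb P$-almost surely and $\sup_{n}|X_n|\in L^p$. Assume moreover that $\rho_{\lambda_1}\ge\rho_{\lambda_2}$ whenever $\lambda_1\le\lambda_2$, and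 define the recovery risk measure $$\rho^{\mathrm{Re}}(X,Y)=\sup_{\lambda\in[0,1]}\rho_\lambda\big(X+(1-\lambda)Y\big),\qquad X,Y\in L^p.$$ Let $\mathcal M_1^q(\mathbb P)$ be the set of probability measures $\mathbb Q\ll\mathbb P$ on $(\Omega,\mathcal F)$ with $\frac{d\mathbb Q}{d\mathbb P}\in L^q$, and let $\mathcal A_\lambda=\{Z\in L^p:\rho_\lambda(Z)\le 0\}$. Then for all $X,Y\in L^p$ $$\rho^{\mathrm{Re}}(X,Y)=\sup_{\mathbb Q\in\mathcal M_1^q(\mathbb P)}\big(\mathbb E_{\mathbb Q}(-X)-\alpha_Y(\mathbb Q)\big),$$ where, for every $\mathbb Q\in\mathcal M_1^q(\mathbb P)$, $$\alpha_Y(\mathbb Q)=\mathbb E_{\mathbb Q}(Y)+\inf_{\lambda\in[0,1]}\Big(\sup_{Z\in\mathcal A_\lambda}\mathbb E_{\mathbb Q}(-Z)-\lambda\,\mathbb E_{\mathbb Q}(Y)\Big)\in[-\infty,\infty],$$ with the convention $\sup\emptyset=-\infty$. -/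

import Mathlib

open MeasureTheory Filter Topology
open scoped ENNReal

noncomputable section

namespace RecoveryRisk

variable {Ω : Type*} [MeasurableSpace Ω]

/-- A monetary risk measure on `L^p(P)`: a map with values in `ℝ ∪ {∞}` (an extended real function
that never takes the value `-∞`) that is cash invariant and monotone. It may be identically `∞`. -/
structure IsMonetary (P : Measure Ω) [IsProbabilityMeasure P] (p : ℝ≥0∞)
    (ρ : Lp ℝ p P → EReal) : Prop where
  ne_bot : ∀ X, ρ X ≠ ⊥
  cash_invariant : ∀ (X : Lp ℝ p P) (m : ℝ), ρ (X + Lp.const p P m) = ρ X - (m : EReal)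
  monotone : ∀ X₁ X₂ : Lp ℝ p P, (∀ᵐ ω ∂P, X₂ ω ≤ X₁ ω) → ρ X₁ ≤ ρ X₂

/-- Convexity of a map `L^p(P) → ℝ ∪ {∞}` (with the convention `0 * ∞ = 0`). -/
def IsConvex (P : Measure Ω) (p : ℝ≥0∞) (ρ : Lp ℝ p P → EReal) : Prop :=
  ∀ (X₁ X₂ : Lp ℝ p P) (a : ℝ), 0 ≤ a → a ≤ 1 →
    ρ (a • X₁ + (1 - a) • X₂) ≤ (a : EReal) * ρ X₁ + ((1 - a : ℝ) : EReal) * ρ X₂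

/-- The Fatou property: lower semicontinuity along almost surely convergent sequences whose
supremum `sup_n |X_n|` belongs to `L^p`. Almost sure convergence makes `(|X_n ω|)_n` bounded for
almost every `ω`, so that the real supremum below is the actual supremum almost surely. -/
def HasFatouProperty (P : Measure Ω) (p : ℝ≥0∞) (ρ : Lp ℝ p P → EReal) : Prop :=
  ∀ (Xs : ℕ → Lp ℝ p P) (X : Lp ℝ p P),
    (∀ᵐ ω ∂P, Tendsto (fun n => Xs n ω) atTop (𝓝 (X ω))) →
    MemLp (fun ω => ⨆ n, |Xs n ω|) p P →
    ρ X ≤ liminf (fun n => ρ (Xs n)) atTop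

/-- The recovery risk measure `sup_{l ∈ [0,1]} ρ_l (X + (1 - l) Y)` of a family `(ρ_l)`. -/
def recoveryRisk {P : Measure Ω} {p : ℝ≥0∞} (ρ : Set.Icc (0 : ℝ) 1 → Lp ℝ p P → EReal)
    (X Y : Lp ℝ p P) : EReal :=
  ⨆ l : Set.Icc (0 : ℝ) 1, ρ l (X + (1 - (l : ℝ)) • Y)

/-- The set of probability measures `Q ≪ P` whose density `dQ/dP` belongs to `L^q(P)`. -/
def dualMeasures (P : Measure Ω) (q : ℝ≥0∞) : Set (Measure Ω) :=
  {Q | IsProbabilityMeasure Q ∧ Q ≪ P ∧ MemLp (fun ω => (Q.rnDeriv P ω).toReal) q P}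

/-- The acceptance set `{X ∈ L^p ; ρ X ≤ 0}`. -/
def acceptanceSet {P : Measure Ω} {p : ℝ≥0∞} (ρ : Lp ℝ p P → EReal) : Set (Lp ℝ p P) :=
  {X | ρ X ≤ 0}

/-- The penalty `α_Y(Q) = E_Q(Y) + inf_{l ∈ [0,1]} (sup_{Z ∈ A_l} E_Q(-Z) - l E_Q(Y))`, where
`A_l` is the acceptance set of `ρ_l`; it is an extended real number, and `sup ∅ = -∞`. -/
def penalty {P : Measure Ω} {p : ℝ≥0∞} (ρ : Set.Icc (0 : ℝ) 1 → Lp ℝ p P → EReal)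
    (Y : Lp ℝ p P) (Q : Measure Ω) : EReal :=
  ((∫ ω, Y ω ∂Q : ℝ) : EReal) +
    ⨅ l : Set.Icc (0 : ℝ) 1,
      ((⨆ Z ∈ acceptanceSet (ρ l), ((∫ ω, -Z ω ∂Q : ℝ) : EReal)) -
        (((l : ℝ) * ∫ ω, Y ω ∂Q : ℝ) : EReal))

/-- All expectations `E_Q(X)`, for `X ∈ L^p(P)` and `Q` with density in `L^q(P)`, are those of
integrable functions. -/
theorem integrable_of_mem_dualMeasures {P : Measure Ω} [IsProbabilityMeasure P] {p q : ℝ≥0∞}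
    (hpq : p.HolderConjugate q) {Q : Measure Ω} (hQ : Q ∈ dualMeasures P q) (X : Lp ℝ p P) :
    Integrable (fun ω => X ω) Q := by
  obtain ⟨h1, h2, h3⟩ := hQ
  rw [← integrable_rnDeriv_smul_iff h2]
  have := hpq.symm
  exact memLp_one_iff_integrable.mp ((Lp.memLp X).smul h3)

end RecoveryRisk

end

/-! Each risk measure satisfies ρ(X) = sup_Q (E_Q(-X) - sup_{Z ∈ A} E_Q(-Z))
(`IsMonetary.dual_representation`). Inserting X + (1 - λ)Y and exchanging the suprema over λ and Q
leaves, for fixed Q, a supremum over λ that is E_Q(-X) minus the penalty; the expectations are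
finite, so this is safe in `EReal`.

For the representation, c < ρ(X) means that X + c lies outside the acceptance set A, which is
convex, upward closed and closed under dominated almost sure limits. A separating functional is
positive because A is upward closed. If it is also order continuous, it is integration against a
measure, and boundedness on L^p puts the density in L^q.

Order continuity is the difficulty. For p < ∞ it follows from norm continuity, by dominated
convergence. For p = ∞ a norm continuous functional need not be countably additive; a Krein–Šmulian
type argument is used instead. Bounded parts of A are closed in L^2, and
`exists_separating_of_isClosed_image` separates by a functional that is L^2-continuous on bounded
sets. -/

/-! ### Separation through an injection into a Hilbert space -/

section Separation

/-- A decreasing sequence of nonempty, bounded, closed, convex subsets of a Hilbert space has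
nonempty intersection. -/
theorem nonempty_iInter_of_antitone_of_isClosed_of_convex {H : Type*} [NormedAddCommGroup H]
    [InnerProductSpace ℝ H] [CompleteSpace H] {K : ℕ → Set H} (hanti : Antitone K)
    (hconv : ∀ n, Convex ℝ (K n)) (hclosed : ∀ n, IsClosed (K n)) (hne : ∀ n, (K n).Nonempty)
    (hbdd : Bornology.IsBounded (K 0)) : (⋂ n, K n).Nonempty := by
  choose x hxK hx using fun n =>
    exists_norm_eq_iInf_of_complete_convex (hne n) (hclosed n).isComplete (hconv n) 0
  -- The variational inequality for the projection `x n` of 0 onto `K n`, tested at `x m`. It makes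
  -- the squared norms increasing; being bounded, they force `x` to be Cauchy.
  have hinner : ∀ n m, n ≤ m → ‖x m - x n‖ ^ 2 ≤ ‖x m‖ ^ 2 - ‖x n‖ ^ 2 := by
    intro n m hnm
    have h := (norm_eq_iInf_iff_real_inner_le_zero (hconv n) (hxK n)).1 (hx n) (x m)
      (hanti hnm (hxK m))
    rw [zero_sub, inner_neg_left, inner_sub_right, real_inner_self_eq_norm_sq] at h
    rw [norm_sub_sq_real, real_inner_comm]
    linarith
  obtain ⟨C, hC⟩ := hbdd.exists_norm_le
  have hmono : Monotone fun n => ‖x n‖ ^ 2 := by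
    intro n m hnm
    have := hinner n m hnm
    have := sq_nonneg ‖x m - x n‖
    dsimp only
    linarith
  have hbound : BddAbove (Set.range fun n => ‖x n‖ ^ 2) := by
    refine ⟨C ^ 2, ?_⟩
    rintro _ ⟨n, rfl⟩
    exact pow_le_pow_left₀ (norm_nonneg _) (hC _ (hanti (Nat.zero_le n) (hxK n))) 2
  have hcauchy : CauchySeq x := by
    rw [Metric.cauchySeq_iff']
    intro ε hε
    obtain ⟨N, hN⟩ := Metric.cauchySeq_iff'.1
      (tendsto_atTop_ciSup hmono hbound).cauchySeq (ε ^ 2) (by positivity)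
    refine ⟨N, fun n hn => ?_⟩
    have h1 := hN n hn
    rw [Real.dist_eq] at h1
    have h2 := (hinner N n hn).trans_lt ((le_abs_self _).trans_lt h1)
    rw [dist_eq_norm]
    exact lt_of_pow_lt_pow_left₀ 2 hε.le h2
  obtain ⟨y, hy⟩ := cauchySeq_tendsto_of_complete hcauchy
  refine ⟨y, Set.mem_iInter.2 fun n => (hclosed n).mem_of_tendsto hy ?_⟩
  filter_upwards [eventually_ge_atTop n] with m hm using hanti hm (hxK m)

/-- Two disjoint closed convex subsets of a Hilbert space, one of which is bounded, have positive
distance. -/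
theorem exists_pos_forall_le_dist_of_disjoint {H : Type*} [NormedAddCommGroup H]
    [InnerProductSpace ℝ H] [CompleteSpace H] {C D : Set H} (hC : Convex ℝ C) (hC' : IsClosed C)
    (hCb : Bornology.IsBounded C) (hD : Convex ℝ D) (hD' : IsClosed D) (hCD : Disjoint C D) :
    ∃ ε : ℝ, 0 < ε ∧ ∀ c ∈ C, ∀ d ∈ D, ε ≤ dist c d := by
  by_contra! h
  have hpos : ∀ n : ℕ, (0 : ℝ) < 1 / ((n : ℝ) + 1) := fun n => Nat.one_div_pos_of_nat
  -- At distance zero all these sets are nonempty, and a common point lies in `C` and in the closure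
  -- of `D`.
  have hK := nonempty_iInter_of_antitone_of_isClosed_of_convex
    (K := fun n : ℕ => C ∩ Metric.cthickening (1 / ((n : ℝ) + 1)) D) ?_ ?_ ?_ ?_ ?_
  · obtain ⟨c, hc⟩ := hK
    rw [Set.mem_iInter] at hc
    refine Set.disjoint_left.1 hCD (hc 0).1 ?_
    rw [← hD'.closure_eq, Metric.closure_eq_iInter_cthickening D]
    refine Set.mem_iInter₂.2 fun δ hδ => ?_
    obtain ⟨n, hn⟩ := exists_nat_one_div_lt hδ
    exact Metric.cthickening_mono hn.le _ (hc n).2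
  · intro n m hnm
    refine Set.inter_subset_inter_right _ (Metric.cthickening_mono ?_ _)
    exact Nat.one_div_le_one_div hnm
  · exact fun n => hC.inter (hD.cthickening _)
  · exact fun n => hC'.inter Metric.isClosed_cthickening
  · intro n
    obtain ⟨c, hc, d, hd, hcd⟩ := h _ (hpos n)
    exact ⟨c, hc, Metric.mem_cthickening_of_dist_le c d _ D hd hcd.le⟩
  · exact hCb.subset Set.inter_subset_left

/-- Separation of the origin from a convex set `A` by a functional which is continuous on bounded
sets for the topology induced by an injection `T` into a Hilbert space. It is enough that the
intersections of `A` with balls are closed in the Hilbert space. -/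
theorem exists_separating_of_isClosed_image {E H : Type*} [NormedAddCommGroup E] [NormedSpace ℝ E]
    [NormedAddCommGroup H] [InnerProductSpace ℝ H] [CompleteSpace H] (T : E →L[ℝ] H)
    (hT : Function.Injective T)
    (hball : ∀ n : ℕ, IsClosed (T '' Metric.closedBall 0 (n : ℝ)))
    {A : Set E} (hA : Convex ℝ A)
    (hAball : ∀ n : ℕ, IsClosed (T '' (A ∩ Metric.closedBall 0 (n : ℝ)))) (h0 : (0 : E) ∉ A) :
    ∃ (f : E →L[ℝ] ℝ) (u : ℝ), 0 < u ∧ (∀ a ∈ A, u ≤ f a) ∧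
      ∀ r ε : ℝ, 0 < ε → ∃ δ > 0, ∀ x, ‖x‖ ≤ r → ‖T x‖ ≤ δ → |f x| ≤ ε := by
  -- Invariant for neighbourhoods of 0 grown inside larger and larger balls while avoiding `A`.
  let Q : ℕ → Set E → Prop := fun n V => Convex ℝ V ∧ V ⊆ Metric.closedBall 0 (n : ℝ) ∧
    IsClosed (T '' V) ∧ (0 : E) ∈ V ∧ Disjoint V A
  have hstep : ∀ n V, ∃ V', Q n V → Q (n + 1) V' ∧ V ⊆ V' ∧
      ∃ δ > 0, ∀ x, ‖x‖ ≤ n + 1 → ‖T x‖ ≤ δ → x ∈ V' := by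
    intro n V
    by_cases hQ : Q n V
    swap
    · exact ⟨V, fun h => absurd h hQ⟩
    obtain ⟨hV, hVn, hVc, hV0, hVA⟩ := hQ
    have hdisj : Disjoint (T '' V) (T '' (A ∩ Metric.closedBall 0 ((n + 1 : ℕ) : ℝ))) := by
      rw [Set.disjoint_image_iff hT]
      exact hVA.mono_right Set.inter_subset_left
    obtain ⟨ε, hε, hdist⟩ := exists_pos_forall_le_dist_of_disjoint
      (hV.linear_image T.toLinearMap) hVc
      (T.lipschitz.isBounded_image (Metric.isBounded_closedBall.subset hVn))
      ((hA.inter (convex_closedBall 0 _)).linear_image T.toLinearMap) (hAball (n + 1)) hdisj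
    have hVne : (T '' V).Nonempty := ⟨T 0, 0, hV0, rfl⟩
    have hsub : V ⊆ Metric.closedBall 0 ((n + 1 : ℕ) : ℝ) :=
      hVn.trans (Metric.closedBall_subset_closedBall (by push_cast; linarith))
    -- Thickening by half of the gap `ε` to the part of `A` in the next ball keeps the new set
    -- disjoint from `A`.
    refine ⟨Metric.closedBall 0 ((n + 1 : ℕ) : ℝ) ∩ T ⁻¹' Metric.cthickening (ε / 2) (T '' V),
      fun _ => ⟨⟨?_, Set.inter_subset_left, ?_, ?_, ?_⟩, ?_, ε / 2, half_pos hε, ?_⟩⟩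
    · exact (convex_closedBall 0 _).inter
        (((hV.linear_image T.toLinearMap).cthickening _).linear_preimage T.toLinearMap)
    · rw [Set.image_inter_preimage]
      exact (hball (n + 1)).inter Metric.isClosed_cthickening
    · exact ⟨hsub hV0, Metric.self_subset_cthickening _ ⟨0, hV0, rfl⟩⟩
    · refine Set.disjoint_left.2 fun x hx hxA => ?_
      have h1 : Metric.infDist (T x) (T '' V) ≤ ε / 2 := 
        ENNReal.toReal_le_of_le_ofReal (half_pos hε).le (Metric.mem_cthickening_iff.1 hx.2)
      have h2 : ε ≤ Metric.infDist (T x) (T '' V) := by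
        refine (Metric.le_infDist hVne).2 fun y hy => ?_
        rw [dist_comm]
        exact hdist y hy _ ⟨x, ⟨hxA, hx.1⟩, rfl⟩
      linarith
    · exact fun x hx => ⟨hsub hx, Metric.self_subset_cthickening _ ⟨x, hx, rfl⟩⟩
    · intro x hx hTx
      refine ⟨by simpa using hx, Metric.mem_cthickening_of_dist_le (T x) (T 0) _ _ ⟨0, hV0, rfl⟩ ?_⟩
      simpa using hTx
  choose g hg using hstep
  let V : ℕ → Set E := fun n => Nat.rec {0} g n
  have hV : ∀ n, Q n (V n) := by
    intro n
    induction n with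
    | zero => exact ⟨convex_singleton 0, by simp [V], by simp [V], rfl, by simpa [V] using h0⟩
    | succ n ih => exact (hg n (V n) ih).1
  have hVmono : Monotone V := monotone_nat_of_le_succ fun n => (hg n (V n) (hV n)).2.1
  choose δ hδ hVδ using fun n => (hg n (V n) (hV n)).2.2
  have hint : ∀ n : ℕ, ∀ x, ‖x‖ < n + 1 → ‖T x‖ < δ n → x ∈ interior (⋃ n, V n) := by
    intro n x hx hTx
    have hopen : IsOpen {x : E | ‖x‖ < n + 1 ∧ ‖T x‖ < δ n} :=
      (isOpen_lt continuous_norm continuous_const).inter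
        (isOpen_lt T.continuous.norm continuous_const)
    refine interior_maximal ?_ hopen ⟨hx, hTx⟩
    exact fun y hy => Set.mem_iUnion.2 ⟨n + 1, hVδ n y hy.1.le hy.2.le⟩
  have hUconv : Convex ℝ (⋃ n, V n) :=
    hVmono.directed_le.convex_iUnion fun n => (hV n).1
  have hdisj : Disjoint (interior (⋃ n, V n)) A :=
    (Set.disjoint_iUnion_left.2 fun n => (hV n).2.2.2.2).mono_left interior_subset
  obtain ⟨f, u, hfU, hfA⟩ := geometric_hahn_banach_open hUconv.interior isOpen_interior hA hdisj
  have hu : 0 < u := by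
    simpa using hfU 0 (hint 0 0 (by simp) (by simpa using hδ 0))
  refine ⟨f, u, hu, hfA, fun r ε hε => ?_⟩
  -- The bound `f < u` near 0 will be applied to `±(u / ε) • x`, which gives `|f x| ≤ ε`; `n` is
  -- large enough for these points to stay in the ball of radius `n + 1`.
  obtain ⟨n, hn⟩ := exists_nat_gt (u / ε * r)
  have hM : 0 < u / ε := by positivity
  refine ⟨δ n / 2 / (u / ε), by have := hδ n; positivity, fun x hx hTx => ?_⟩
  have h1 : ‖(u / ε) • x‖ < n + 1 := by
    rw [norm_smul, Real.norm_of_nonneg hM.le]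
    have := mul_le_mul_of_nonneg_left hx hM.le
    linarith
  have h2 : ‖T ((u / ε) • x)‖ < δ n := by
    rw [map_smul, norm_smul, Real.norm_of_nonneg hM.le]
    rw [le_div_iff₀ hM] at hTx
    have := hδ n
    linarith
  have h3 := hfU _ (hint n _ h1 h2)
  have h4 := hfU (-((u / ε) • x)) (hint n _ (by rwa [norm_neg]) (by rwa [map_neg, norm_neg]))
  rw [map_neg, map_smul, smul_eq_mul] at h4
  rw [map_smul, smul_eq_mul] at h3
  have h5 : u / ε * |f x| ≤ u := by
    rw [← abs_of_pos hM, ← abs_mul, abs_le]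
    constructor <;> linarith
  have h6 : u / ε * |f x| ≤ u / ε * ε := by rwa [div_mul_cancel₀ _ hε.ne']
  exact le_of_mul_le_mul_left h6 hM

end Separation

/-! ### Order continuous functionals and their measures -/

namespace RecoveryRisk

/-- A functional on `L^p` is order continuous if it is continuous along dominated, almost surely
convergent sequences. -/
def IsOrderContinuous {Ω : Type*} [MeasurableSpace Ω] {P : Measure Ω} {p : ℝ≥0∞}
    (f : Lp ℝ p P → ℝ) : Prop :=
  ∀ (Xs : ℕ → Lp ℝ p P) (X G : Lp ℝ p P), (∀ n, ∀ᵐ ω ∂P, |Xs n ω| ≤ G ω) →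
    (∀ᵐ ω ∂P, Tendsto (fun n => Xs n ω) atTop (𝓝 (X ω))) →
    Tendsto (fun n => f (Xs n)) atTop (𝓝 (f X))

/-- Dominated convergence in `L^p`, `p < ∞`. -/
theorem tendsto_Lp_of_dominated {Ω : Type*} [MeasurableSpace Ω] {P : Measure Ω}
    [IsFiniteMeasure P] {p : ℝ≥0∞} [hp : Fact (1 ≤ p)] (hp' : p ≠ ∞) (Xs : ℕ → Lp ℝ p P)
    (X G : Lp ℝ p P) (hG : ∀ n, ∀ᵐ ω ∂P, |Xs n ω| ≤ G ω)
    (hX : ∀ᵐ ω ∂P, Tendsto (fun n => Xs n ω) atTop (𝓝 (X ω))) :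
    Tendsto Xs atTop (𝓝 X) := by
  rw [Lp.tendsto_Lp_iff_tendsto_eLpNorm']
  refine tendsto_Lp_finite_of_tendsto_ae hp.out hp' (fun n => Lp.aestronglyMeasurable _)
    (Lp.memLp X) ?_ hX
  intro ε hε
  obtain ⟨δ, hδ, h⟩ := (Lp.memLp G).eLpNorm_indicator_le hp.out hp' hε
  refine ⟨δ, hδ, fun n s hs hPs => (eLpNorm_mono_ae ?_).trans (h s hs hPs)⟩
  filter_upwards [hG n] with ω hω
  by_cases hωs : ω ∈ s
  · simpa [hωs] using hω.trans (le_abs_self _)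
  · simp [hωs]

theorem map_le_map_of_nonneg {Ω : Type*} [MeasurableSpace Ω] {P : Measure Ω} {p : ℝ≥0∞}
    {f : Lp ℝ p P →ₗ[ℝ] ℝ} (hf : ∀ X, 0 ≤ X → 0 ≤ f X) {X Y : Lp ℝ p P} (h : X ≤ Y) : f X ≤ f Y := by
  have := hf (Y - X) (sub_nonneg.2 h)
  rw [map_sub] at this
  linarith

section Representation

variable {Ω : Type*} [MeasurableSpace Ω] {P : Measure Ω} [IsFiniteMeasure P] {p : ℝ≥0∞}

theorem sum_indicatorConstLp {E : ℕ → Set Ω} (hE : ∀ i, MeasurableSet (E i))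
    (hd : Pairwise (Function.onFun Disjoint E)) (c : ℝ) (n : ℕ) :
    ∑ i ∈ Finset.range n, indicatorConstLp p (hE i) (measure_ne_top P _) c =
      indicatorConstLp p (Finset.measurableSet_biUnion (Finset.range n) fun i _ => hE i)
        (measure_ne_top P _) c := by
  induction n with
  | zero => simp
  | succ n ih =>
    have hdisj : Disjoint (⋃ i ∈ Finset.range n, E i) (E n) := by
      simp only [Set.disjoint_iUnion_left]
      intro i hi
      exact hd (Finset.mem_range.1 hi).ne
    rw [Finset.sum_range_succ, ih, ← indicatorConstLp_disjoint_union _ _ _ _ hdisj]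
    congr 1
    rw [Finset.range_add_one, Finset.set_biUnion_insert, Set.union_comm]

theorem tendsto_indicator_biUnion_range {Ω : Type*} (E : ℕ → Set Ω) (ω : Ω) :
    Tendsto (fun n => (⋃ i ∈ Finset.range n, E i).indicator (fun _ => (1 : ℝ)) ω) atTop
      (𝓝 ((⋃ i, E i).indicator (fun _ => (1 : ℝ)) ω)) := by
  by_cases h : ω ∈ ⋃ i, E i
  · obtain ⟨i, hi⟩ := Set.mem_iUnion.1 h
    refine tendsto_const_nhds.congr' ?_
    filter_upwards [eventually_gt_atTop i] with n hn
    rw [Set.indicator_of_mem h, Set.indicator_of_mem]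
    exact Set.mem_biUnion (Finset.mem_range.2 hn) hi
  · refine tendsto_const_nhds.congr fun n => ?_
    rw [Set.indicator_of_notMem h, Set.indicator_of_notMem]
    intro h'
    obtain ⟨i, -, hi⟩ := Set.mem_iUnion₂.1 h'
    exact h (Set.mem_iUnion.2 ⟨i, hi⟩)

theorem indicatorConstLp_one_nonneg {s : Set Ω} (hs : MeasurableSet s) :
    0 ≤ indicatorConstLp p hs (measure_ne_top P s) (1 : ℝ) := by
  rw [← Lp.coeFn_nonneg]
  filter_upwards [indicatorConstLp_coeFn (p := p) (hs := hs) (hμs := measure_ne_top P s)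
    (c := (1 : ℝ))] with ω hω
  rw [hω]
  exact Set.indicator_nonneg (fun _ _ => zero_le_one) _

/-- The partial unions are dominated by the constant 1, so order continuity upgrades finite
additivity to countable additivity. -/
theorem hasSum_indicatorConstLp {f : Lp ℝ p P →ₗ[ℝ] ℝ} (hf : ∀ X, 0 ≤ X → 0 ≤ f X)
    (hfc : IsOrderContinuous f) {E : ℕ → Set Ω} (hE : ∀ i, MeasurableSet (E i))
    (hd : Pairwise (Function.onFun Disjoint E)) :
    HasSum (fun i => f (indicatorConstLp p (hE i) (measure_ne_top P _) 1))
      (f (indicatorConstLp p (MeasurableSet.iUnion hE) (measure_ne_top P _) 1)) := by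
  rw [hasSum_iff_tendsto_nat_of_nonneg fun i => hf _ (indicatorConstLp_one_nonneg _)]
  simp_rw [← map_sum, sum_indicatorConstLp hE hd]
  refine hfc _ _ (Lp.const p P 1) (fun n => ?_) ?_
  · filter_upwards [Lp.coeFn_const p P (1 : ℝ), indicatorConstLp_coeFn (p := p)
      (hs := Finset.measurableSet_biUnion (Finset.range n) fun i _ => hE i)
      (hμs := measure_ne_top P _) (c := (1 : ℝ))] with ω h1 h2
    rw [h1, h2]
    refine (norm_indicator_le_norm_self (fun _ => (1 : ℝ)) ω).trans (by simp)
  · have h : ∀ n, ∀ᵐ ω ∂P, indicatorConstLp p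
        (Finset.measurableSet_biUnion (Finset.range n) fun i _ => hE i)
        (measure_ne_top P _) (1 : ℝ) ω =
          (⋃ i ∈ Finset.range n, E i).indicator (fun _ => (1 : ℝ)) ω :=
      fun n => indicatorConstLp_coeFn
    filter_upwards [ae_all_iff.2 h, indicatorConstLp_coeFn (p := p)
      (hs := MeasurableSet.iUnion hE) (hμs := measure_ne_top P _) (c := (1 : ℝ))] with ω h1 h2
    rw [h2]
    simp_rw [h1]
    exact tendsto_indicator_biUnion_range E ω

/-- The measure `E ↦ f (1_E)` of a positive, order continuous functional. -/
theorem exists_measure_indicatorConstLp {f : Lp ℝ p P →ₗ[ℝ] ℝ} (hf : ∀ X, 0 ≤ X → 0 ≤ f X)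
    (hfc : IsOrderContinuous f) :
    ∃ μ : Measure Ω, IsFiniteMeasure μ ∧ μ ≪ P ∧ ∀ (s : Set Ω) (hs : MeasurableSet s),
      μ.real s = f (indicatorConstLp p hs (measure_ne_top P s) 1) := by
  let m : ∀ s : Set Ω, MeasurableSet s → ℝ≥0∞ := fun s hs =>
    ENNReal.ofReal (f (indicatorConstLp p hs (measure_ne_top P s) 1))
  have m0 : m ∅ MeasurableSet.empty = 0 := by simp [m]
  have mU : ∀ ⦃E : ℕ → Set Ω⦄ (hE : ∀ i, MeasurableSet (E i)),
      Pairwise (Function.onFun Disjoint E) →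
      m (⋃ i, E i) (MeasurableSet.iUnion hE) = ∑' i, m (E i) (hE i) := by
    intro E hE hd
    have h := hasSum_indicatorConstLp hf hfc hE hd
    simp only [m]
    rw [← h.tsum_eq, ENNReal.ofReal_tsum_of_nonneg
      (fun i => hf _ (indicatorConstLp_one_nonneg _)) h.summable]
  have hm : ∀ s (hs : MeasurableSet s), Measure.ofMeasurable m m0 mU s = m s hs :=
    Measure.ofMeasurable_apply
  refine ⟨Measure.ofMeasurable m m0 mU, ⟨?_⟩, ?_, fun s hs => ?_⟩
  · rw [hm _ MeasurableSet.univ]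
    exact ENNReal.ofReal_lt_top
  · refine Measure.AbsolutelyContinuous.mk fun s hs hPs => ?_
    have : indicatorConstLp p hs (measure_ne_top P s) (1 : ℝ) = 0 := by
      rw [← indicatorConstLp_empty (p := p) (μ := P) (c := (1 : ℝ)),
        indicatorConstLp_inj _ _ _ _ one_ne_zero]
      exact ae_eq_empty.2 hPs
    rw [hm s hs]
    simp only [m, this, map_zero, ENNReal.ofReal_zero]
  · rw [measureReal_def, hm s hs]
    exact ENNReal.toReal_ofReal (hf _ (indicatorConstLp_one_nonneg _))

theorem map_simpleFunc_eq_integral {f : Lp ℝ p P →ₗ[ℝ] ℝ} {μ : Measure Ω} [IsFiniteMeasure μ]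
    (hμ : ∀ (s : Set Ω) (hs : MeasurableSet s),
      μ.real s = f (indicatorConstLp p hs (measure_ne_top P s) 1)) (g : SimpleFunc Ω ℝ) :
    f ((g.memLp_of_isFiniteMeasure p P).toLp g) = ∫ ω, g ω ∂μ := by
  induction g using SimpleFunc.induction with
  | @const c s hs =>
    have h1 : ((SimpleFunc.piecewise s hs (SimpleFunc.const Ω c)
        (SimpleFunc.const Ω 0)).memLp_of_isFiniteMeasure p P).toLp _ =
        c • indicatorConstLp p hs (measure_ne_top P s) (1 : ℝ) := by
      rw [indicatorConstLp, ← MemLp.toLp_const_smul]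
      congr 1
      ext ω
      by_cases hω : ω ∈ s <;> simp [hω]
    rw [h1, map_smul, ← hμ s hs]
    simp [SimpleFunc.coe_piecewise, Set.piecewise_eq_indicator, integral_indicator hs, mul_comm]
  | add _ ih₁ ih₂ =>
    rename_i g₁ g₂ _
    have h1 : ((g₁ + g₂).memLp_of_isFiniteMeasure p P).toLp _ =
        (g₁.memLp_of_isFiniteMeasure p P).toLp g₁ + (g₂.memLp_of_isFiniteMeasure p P).toLp g₂ :=
      rfl
    rw [h1, map_add, ih₁, ih₂]
    exact (integral_add (SimpleFunc.integrable_of_isFiniteMeasure _)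
      (SimpleFunc.integrable_of_isFiniteMeasure _)).symm

/-- A positive, order continuous functional on `L^p` is the integral with respect to a measure. -/
theorem exists_measure_forall_integral_eq {f : Lp ℝ p P →ₗ[ℝ] ℝ} (hf : ∀ X, 0 ≤ X → 0 ≤ f X)
    (hfc : IsOrderContinuous f) :
    ∃ μ : Measure Ω, IsFiniteMeasure μ ∧ μ ≪ P ∧
      ∀ X : Lp ℝ p P, Integrable X μ ∧ ∫ ω, X ω ∂μ = f X := by
  obtain ⟨μ, hμfin, hμP, hμ⟩ := exists_measure_indicatorConstLp hf hfc
  refine ⟨μ, hμfin, hμP, fun X => ?_⟩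
  have hXm : Measurable X := (Lp.stronglyMeasurable X).measurable
  let s : ℕ → SimpleFunc Ω ℝ := SimpleFunc.approxOn X hXm Set.univ 0 (Set.mem_univ 0)
  have hs : ∀ ω, Tendsto (fun n => s n ω) atTop (𝓝 (X ω)) := fun ω =>
    SimpleFunc.tendsto_approxOn hXm _ (by simp)
  have hsX : ∀ n ω, ‖s n ω‖ ≤ ‖X ω‖ + ‖X ω‖ := fun n ω =>
    SimpleFunc.norm_approxOn_zero_le hXm _ ω n
  have hsL : ∀ n, ∀ᵐ ω ∂P, ((s n).memLp_of_isFiniteMeasure p P).toLp _ ω = s n ω :=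
    fun n => MemLp.coeFn_toLp _
  have hint : Integrable X μ := by
    refine ⟨(Lp.stronglyMeasurable X).aestronglyMeasurable, ?_⟩
    -- An a priori bound from positivity, since `|s n| ≤ 2|X|`; Fatou's lemma then yields
    -- integrability of `X`.
    have hle : ∀ n, ∫⁻ ω, ‖s n ω‖ₑ ∂μ ≤ ENNReal.ofReal (f (|X| + |X|)) := by
      intro n
      have h1 : ∫⁻ ω, ‖s n ω‖ₑ ∂μ = ENNReal.ofReal (∫ ω, (s n).map (fun x => ‖x‖) ω ∂μ) := by
        rw [← ofReal_integral_norm_eq_lintegral_enorm (SimpleFunc.integrable_of_isFiniteMeasure _)]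
        rfl
      rw [h1, ← map_simpleFunc_eq_integral hμ]
      refine ENNReal.ofReal_le_ofReal (map_le_map_of_nonneg hf ?_)
      rw [← Lp.coeFn_le]
      filter_upwards [MemLp.coeFn_toLp (((s n).map fun x => ‖x‖).memLp_of_isFiniteMeasure p P),
        Lp.coeFn_add |X| |X|, Lp.coeFn_abs X] with ω h2 h3 h4
      rw [h2, h3, Pi.add_apply, h4]
      exact hsX n ω
    refine lt_of_le_of_lt ?_ (ENNReal.ofReal_lt_top (r := f (|X| + |X|)))
    calc ∫⁻ ω, ‖X ω‖ₑ ∂μ = ∫⁻ ω, liminf (fun n => ‖s n ω‖ₑ) atTop ∂μ := by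
          refine lintegral_congr fun ω => ?_
          exact ((hs ω).enorm).liminf_eq.symm
      _ ≤ liminf (fun n => ∫⁻ ω, ‖s n ω‖ₑ ∂μ) atTop :=
          lintegral_liminf_le fun n => (s n).measurable.enorm
      _ ≤ ENNReal.ofReal (f (|X| + |X|)) :=
          liminf_le_of_le (by isBoundedDefault) fun b hb => by
            obtain ⟨n, hn⟩ := hb.exists
            exact hn.trans (hle n)
  refine ⟨hint, ?_⟩
  have h1 : Tendsto (fun n => ∫ ω, s n ω ∂μ) atTop (𝓝 (∫ ω, X ω ∂μ)) :=
    tendsto_integral_of_dominated_convergence (fun ω => ‖X ω‖ + ‖X ω‖)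
      (fun n => (s n).aestronglyMeasurable) (hint.norm.add hint.norm)
      (fun n => Eventually.of_forall (hsX n)) (Eventually.of_forall hs)
  have h2 : Tendsto (fun n => f (((s n).memLp_of_isFiniteMeasure p P).toLp _)) atTop
      (𝓝 (f X)) := by
    refine hfc _ X (|X| + |X|) (fun n => ?_) ?_
    · filter_upwards [hsL n, Lp.coeFn_add |X| |X|, Lp.coeFn_abs X] with ω h2 h3 h4
      rw [h2, h3, Pi.add_apply, h4]
      exact hsX n ω
    · filter_upwards [ae_all_iff.2 hsL] with ω hω
      simp_rw [hω]
      exact hs ω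
  simp_rw [map_simpleFunc_eq_integral hμ] at h2
  exact tendsto_nhds_unique h1 h2

end Representation

/-! ### Densities in L^q -/

section Density

variable {Ω : Type*} [MeasurableSpace Ω] {P : Measure Ω} [IsFiniteMeasure P] {p q : ℝ≥0∞}

theorem integral_le_of_forall_Lp {Ω : Type*} [MeasurableSpace Ω] {P : Measure Ω} {p : ℝ≥0∞}
    [Fact (1 ≤ p)] {μ : Measure Ω} (hμP : μ ≪ P) {C : ℝ}
    (hC : ∀ X : Lp ℝ p P, 0 ≤ X → ∫ ω, X ω ∂μ ≤ C * ‖X‖) {g : Ω → ℝ} (hg : MemLp g p P)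
    (hg0 : ∀ ω, 0 ≤ g ω) : ∫ ω, g ω ∂μ ≤ C * (eLpNorm g p P).toReal := by
  have h := hC (hg.toLp g) ?_
  · rwa [integral_congr_ae (hμP.ae_le hg.coeFn_toLp), Lp.norm_toLp] at h
  · rw [← Lp.coeFn_nonneg]
    filter_upwards [hg.coeFn_toLp] with ω hω
    rw [hω]
    exact hg0 ω

/-- Testing with indicators gives `μ s ≤ C * P s`, so the density is at most `C` almost everywhere.
-/
theorem memLp_top_rnDeriv {μ : Measure Ω} [IsFiniteMeasure μ] (hμP : μ ≪ P) {C : ℝ}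
    (hC : ∀ X : Lp ℝ 1 P, 0 ≤ X → ∫ ω, X ω ∂μ ≤ C * ‖X‖) :
    MemLp (fun ω => (μ.rnDeriv P ω).toReal) ∞ P := by
  have hle : μ.rnDeriv P ≤ᵐ[P] fun _ => ENNReal.ofReal C := by
    refine ae_le_of_forall_setLIntegral_le_of_sigmaFinite (Measure.measurable_rnDeriv _ _) ?_
    intro s hs _
    rw [Measure.setLIntegral_rnDeriv hμP, setLIntegral_const]
    have h := integral_le_of_forall_Lp hμP hC
      (memLp_indicator_const 1 hs (1 : ℝ) (Or.inr (measure_ne_top P s)))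
      (fun ω => Set.indicator_nonneg (fun _ _ => zero_le_one) _)
    rw [integral_indicator_const _ hs, smul_eq_mul, mul_one,
      eLpNorm_indicator_const hs one_ne_zero ENNReal.one_ne_top] at h
    simp only [enorm_one, ENNReal.toReal_one, div_one, ENNReal.rpow_one, one_mul] at h
    rw [← ENNReal.ofReal_toReal (measure_ne_top μ s), ← ENNReal.ofReal_toReal (measure_ne_top P s),
      ← ENNReal.ofReal_mul' ENNReal.toReal_nonneg]
    exact ENNReal.ofReal_le_ofReal h
  refine memLp_top_of_bound (Measure.measurable_rnDeriv _ _).ennreal_toReal.aestronglyMeasurable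
    (ENNReal.ofReal C).toReal ?_
  filter_upwards [hle] with ω hω
  rw [Real.norm_of_nonneg ENNReal.toReal_nonneg]
  exact ENNReal.toReal_mono ENNReal.ofReal_ne_top hω

/-- For the truncated density w, test with w^(q-1): since p(q-1) = q, ‖w‖_q^q ≤ ∫ w^(q-1) dμ ≤
C‖w‖_q^(q-1). Truncation makes ‖w‖_q finite, so that the power can be cancelled. -/
theorem eLpNorm_min_rnDeriv_le [Fact (1 ≤ p)] (hpq : p.HolderConjugate q) (hp : p ≠ ∞)
    (hq : q ≠ ∞) {μ : Measure Ω} [IsFiniteMeasure μ] (hμP : μ ≪ P) {C : ℝ}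
    (hC : ∀ X : Lp ℝ p P, 0 ≤ X → ∫ ω, X ω ∂μ ≤ C * ‖X‖) (n : ℕ) :
    eLpNorm (fun ω => min (μ.rnDeriv P ω).toReal n) q P ≤ ENNReal.ofReal C := by
  have hpq' : p.toReal.HolderConjugate q.toReal := ENNReal.HolderConjugate.toReal_of_ne_top hp hq
  set w : Ω → ℝ := fun ω => min (μ.rnDeriv P ω).toReal n with hw
  have hw0 : ∀ ω, 0 ≤ w ω := fun ω => le_min ENNReal.toReal_nonneg n.cast_nonneg
  have hwn : ∀ ω, w ω ≤ n := fun ω => min_le_right _ _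
  have hwm : Measurable w := (Measure.measurable_rnDeriv _ _).ennreal_toReal.min measurable_const
  have hwLp : MemLp w q P := MemLp.of_bound hwm.aestronglyMeasurable n
    (Eventually.of_forall fun ω => by rw [Real.norm_of_nonneg (hw0 ω)]; exact hwn ω)
  have hr : 0 < q.toReal - 1 := hpq'.symm.sub_one_pos
  have hvm : Measurable fun ω => w ω ^ (q.toReal - 1) := hwm.pow_const _
  have hvb : ∀ ω, ‖w ω ^ (q.toReal - 1)‖ ≤ (n : ℝ) ^ (q.toReal - 1) := fun ω => by
    rw [Real.norm_of_nonneg (Real.rpow_nonneg (hw0 ω) _)]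
    exact Real.rpow_le_rpow (hw0 ω) (hwn ω) hr.le
  have hvLp : MemLp (fun ω => w ω ^ (q.toReal - 1)) p P :=
    MemLp.of_bound hvm.aestronglyMeasurable _ (Eventually.of_forall hvb)
  have h1 := integral_le_of_forall_Lp hμP hC hvLp fun ω => Real.rpow_nonneg (hw0 ω) _
  have h2 : eLpNorm (fun ω => w ω ^ (q.toReal - 1)) p P = eLpNorm w q P ^ (q.toReal - 1) := by
    have h := eLpNorm_norm_rpow (p := p) (μ := P) w hr
    have hpq'' : p * ENNReal.ofReal (q.toReal - 1) = q := by
      rw [← ENNReal.ofReal_toReal hp, ← ENNReal.ofReal_mul ENNReal.toReal_nonneg, mul_comm,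
        hpq'.symm.sub_one_mul_conj, ENNReal.ofReal_toReal hq]
    rw [hpq''] at h
    rw [← h]
    simp_rw [Real.norm_of_nonneg (hw0 _)]
  have h3 : ∫ ω, w ω ^ q.toReal ∂P ≤ ∫ ω, w ω ^ (q.toReal - 1) ∂μ := by
    rw [← integral_rnDeriv_smul hμP]
    refine integral_mono_ae ?_ ?_ (Eventually.of_forall fun ω => ?_)
    · have := hwLp.integrable_norm_rpow'
      simpa only [Real.norm_of_nonneg (hw0 _)] using this
    · rw [integrable_rnDeriv_smul_iff hμP]
      exact Integrable.of_bound hvm.aestronglyMeasurable _ (Eventually.of_forall hvb)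
    · dsimp only
      have : w ω ^ q.toReal = w ω * w ω ^ (q.toReal - 1) := by
        rw [← Real.rpow_one_add' (hw0 ω) (by linarith [hpq'.symm.pos])]
        congr 1; ring
      rw [this, smul_eq_mul]
      exact mul_le_mul_of_nonneg_right (min_le_left _ _) (Real.rpow_nonneg (hw0 ω) _)
  set N := (eLpNorm w q P).toReal with hN
  have hN0 : 0 ≤ N := ENNReal.toReal_nonneg
  have h4 : N ^ q.toReal = ∫ ω, w ω ^ q.toReal ∂P := by
    have hI : 0 ≤ ∫ ω, w ω ^ q.toReal ∂P :=
      integral_nonneg fun ω => Real.rpow_nonneg (hw0 ω) _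
    rw [hN, hwLp.eLpNorm_eq_integral_rpow_norm (by rintro rfl; simpa using hpq'.symm.pos) hq]
    simp_rw [Real.norm_of_nonneg (hw0 _)]
    rw [ENNReal.toReal_ofReal (Real.rpow_nonneg hI _), Real.rpow_inv_rpow hI hpq'.symm.pos.ne']
  rw [h2, ← ENNReal.toReal_rpow] at h1
  have h5 : N ^ q.toReal ≤ C * N ^ (q.toReal - 1) := by rw [h4]; exact h3.trans h1
  rw [← ENNReal.ofReal_toReal hwLp.eLpNorm_ne_top]
  refine ENNReal.ofReal_le_ofReal_iff'.2 ?_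
  rcases hN0.eq_or_lt with h0 | h0
  · exact Or.inr h0.symm.le
  · left
    have : N ^ q.toReal = N * N ^ (q.toReal - 1) := by
      rw [← Real.rpow_one_add' hN0 (by linarith [hpq'.symm.pos])]
      congr 1; ring
    rw [this] at h5
    exact le_of_mul_le_mul_right h5 (Real.rpow_pos_of_pos h0 _)

/-- If integration with respect to `μ` is bounded on `L^p(P)`, then the density of `μ` is in
`L^q(P)`. -/
theorem memLp_rnDeriv_of_bounded [hp : Fact (1 ≤ p)] (hpq : p.HolderConjugate q) {μ : Measure Ω}
    [IsFiniteMeasure μ] (hμP : μ ≪ P) {C : ℝ}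
    (hC : ∀ X : Lp ℝ p P, 0 ≤ X → ∫ ω, X ω ∂μ ≤ C * ‖X‖) :
    MemLp (fun ω => (μ.rnDeriv P ω).toReal) q P := by
  by_cases hp' : p = ∞
  · rw [(ENNReal.HolderConjugate.eq_top_iff_eq_one p q).1 hp', memLp_one_iff_integrable]
    exact Measure.integrable_toReal_rnDeriv
  by_cases hq : q = ∞
  · obtain rfl : p = 1 := (ENNReal.HolderConjugate.eq_top_iff_eq_one q p).1 hq
    rw [hq]
    exact memLp_top_rnDeriv hμP hC
  have hm : Measurable fun ω => (μ.rnDeriv P ω).toReal :=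
    (Measure.measurable_rnDeriv _ _).ennreal_toReal
  refine ⟨hm.aestronglyMeasurable, lt_of_le_of_lt ?_ (ENNReal.ofReal_lt_top (r := C))⟩
  refine (Lp.eLpNorm_lim_le_liminf_eLpNorm
    (f := fun n ω => min (μ.rnDeriv P ω).toReal (n : ℝ))
    (fun n => (hm.min measurable_const).aestronglyMeasurable) _
    (Eventually.of_forall fun ω => ?_)).trans ?_
  · refine tendsto_const_nhds.congr' ?_
    obtain ⟨n, hn⟩ := exists_nat_ge (μ.rnDeriv P ω).toReal
    filter_upwards [eventually_ge_atTop n] with m hm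
    exact (min_eq_left (hn.trans (by exact_mod_cast hm))).symm
  · refine liminf_le_of_le (by isBoundedDefault) fun b hb => ?_
    obtain ⟨n, hn⟩ := hb.exists
    exact hn.trans (eLpNorm_min_rnDeriv_le hpq hp' hq hμP hC n)

/-- A positive, order continuous, normalized functional on `L^p` is the expectation with respect
to a probability measure whose density belongs to `L^q`. -/
theorem exists_mem_dualMeasures [Fact (1 ≤ p)] (hpq : p.HolderConjugate q) (f : Lp ℝ p P →L[ℝ] ℝ)
    (hf : ∀ X, 0 ≤ X → 0 ≤ f X) (hfc : IsOrderContinuous f) (hf1 : f (Lp.const p P 1) = 1) :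
    ∃ Q ∈ dualMeasures P q, ∀ X : Lp ℝ p P, Integrable X Q ∧ ∫ ω, X ω ∂Q = f X := by
  obtain ⟨μ, hμ, hμP, h⟩ := exists_measure_forall_integral_eq (f := f.toLinearMap) hf hfc
  refine ⟨μ, ⟨⟨?_⟩, hμP, memLp_rnDeriv_of_bounded hpq hμP (C := ‖f‖) fun X _ => ?_⟩, h⟩
  · have h1 := (h (Lp.const p P 1)).2
    rw [integral_congr_ae (hμP.ae_le (Lp.coeFn_const p P (1 : ℝ)))] at h1
    have h2 : μ.real Set.univ = 1 := by
      simpa using h1.trans hf1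
    rw [← ENNReal.ofReal_toReal (measure_ne_top μ Set.univ)]
    rw [measureReal_def] at h2
    rw [h2, ENNReal.ofReal_one]
  · rw [(h X).2]
    exact (le_abs_self _).trans (f.le_opNorm X)

end Density

/-! ### Fatou closed sets -/

/-- A subset of `L^p` is Fatou closed if it contains the limits of its dominated, almost surely
convergent sequences. -/
def IsFatouClosed {Ω : Type*} [MeasurableSpace Ω] {P : Measure Ω} {p : ℝ≥0∞}
    (A : Set (Lp ℝ p P)) : Prop :=
  ∀ (Xs : ℕ → Lp ℝ p P) (X G : Lp ℝ p P), (∀ n, Xs n ∈ A) → (∀ n, ∀ᵐ ω ∂P, |Xs n ω| ≤ G ω) →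
    (∀ᵐ ω ∂P, Tendsto (fun n => Xs n ω) atTop (𝓝 (X ω))) → X ∈ A

/-- Every convergent sequence in `L^p` has a dominated, almost surely convergent subsequence. -/
theorem exists_subseq_dominated {Ω : Type*} [MeasurableSpace Ω] {P : Measure Ω} {p : ℝ≥0∞}
    [Fact (1 ≤ p)] {Xs : ℕ → Lp ℝ p P} {X : Lp ℝ p P} (h : Tendsto Xs atTop (𝓝 X)) :
    ∃ (φ : ℕ → ℕ) (G : Lp ℝ p P), (∀ n, ∀ᵐ ω ∂P, |Xs (φ n) ω| ≤ G ω) ∧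
      ∀ᵐ ω ∂P, Tendsto (fun n => Xs (φ n) ω) atTop (𝓝 (X ω)) := by
  obtain ⟨φ, hφ, hae⟩ := (tendstoInMeasure_of_tendsto_Lp h).exists_seq_tendsto_ae
  have hlim : Tendsto (fun n => Xs (φ n)) atTop (𝓝 X) := h.comp hφ.tendsto_atTop
  have hev : ∀ k : ℕ, ∀ᶠ n in atTop, ‖Xs (φ n) - X‖ ≤ (1 / 2 : ℝ) ^ k := by
    intro k
    filter_upwards [hlim.eventually (Metric.closedBall_mem_nhds X
      (show (0 : ℝ) < (1 / 2) ^ k by positivity))] with n hn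
    rwa [dist_eq_norm] at hn
  obtain ⟨ψ, hψ, hψk⟩ := extraction_forall_of_eventually' (fun k => (hev k).exists_forall_of_atTop)
  -- Along a geometrically fast subsequence, `|X|` plus the sum of all deviations is a dominating
  -- element of L^p.
  have hsum : Summable fun k => |Xs (φ (ψ k)) - X| := by
    refine Summable.of_norm_bounded summable_geometric_two fun k => ?_
    rw [norm_abs_eq_norm]
    exact hψk k
  refine ⟨φ ∘ ψ, |X| + ∑' k, |Xs (φ (ψ k)) - X|, fun n => ?_, ?_⟩
  · have h1 : |Xs (φ (ψ n))| ≤ |X| + ∑' k, |Xs (φ (ψ k)) - X| := by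
      calc |Xs (φ (ψ n))| = |X + (Xs (φ (ψ n)) - X)| := by rw [add_sub_cancel]
        _ ≤ |X| + |Xs (φ (ψ n)) - X| := abs_add_le _ _
        _ ≤ _ := by
          gcongr
          exact hsum.le_tsum n fun _ _ => abs_nonneg _
    rw [← Lp.coeFn_le] at h1
    filter_upwards [h1, Lp.coeFn_abs (Xs (φ (ψ n)))] with ω h2 h3
    rw [h3] at h2
    exact h2
  · filter_upwards [hae] with ω hω using hω.comp hψ.tendsto_atTop

theorem IsFatouClosed.isClosed {Ω : Type*} [MeasurableSpace Ω] {P : Measure Ω} {p : ℝ≥0∞}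
    [Fact (1 ≤ p)] {A : Set (Lp ℝ p P)} (hA : IsFatouClosed A) : IsClosed A := by
  refine IsSeqClosed.isClosed fun Xs X hXs h => ?_
  obtain ⟨φ, G, hG, hlim⟩ := exists_subseq_dominated h
  exact hA _ X G (fun n => hXs (φ n)) hG hlim

/-! ### The case p = ∞ inside L^2 -/

section Top

variable {Ω : Type*} [MeasurableSpace Ω] {P : Measure Ω} [IsProbabilityMeasure P]

theorem ae_abs_le_norm {Ω : Type*} [MeasurableSpace Ω] {P : Measure Ω} (X : Lp ℝ ∞ P) :
    ∀ᵐ ω ∂P, |X ω| ≤ ‖X‖ := by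
  filter_upwards [ae_le_eLpNormEssSup (f := X) (μ := P)] with ω hω
  rw [← eLpNorm_exponent_top] at hω
  have := ENNReal.toReal_mono (Lp.eLpNorm_ne_top X) hω
  rwa [toReal_enorm] at this

theorem norm_le_of_ae_abs_le {X : Lp ℝ ∞ P} {C : ℝ} (hC : 0 ≤ C) (h : ∀ᵐ ω ∂P, |X ω| ≤ C) :
    ‖X‖ ≤ C := by
  simpa using Lp.norm_le_of_ae_bound (f := X) hC h

/-- The inclusion of `L^∞` into `L^2`. -/
noncomputable def inclusionL2 (P : Measure Ω) [IsProbabilityMeasure P] : Lp ℝ ∞ P →L[ℝ] Lp ℝ 2 P :=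
  LinearMap.mkContinuous
    { toFun := fun X => ((Lp.memLp X).mono_exponent le_top).toLp X
      map_add' := fun X Y => by
        rw [← MemLp.toLp_add]
        exact MemLp.toLp_congr _ _ (Lp.coeFn_add X Y)
      map_smul' := fun c X => by
        rw [RingHom.id_apply, ← MemLp.toLp_const_smul]
        exact MemLp.toLp_congr _ _ (Lp.coeFn_smul c X) } 1 fun X => by
    rw [one_mul, LinearMap.coe_mk, AddHom.coe_mk, Lp.norm_toLp, Lp.norm_def]
    exact ENNReal.toReal_mono (Lp.eLpNorm_ne_top X)
      (eLpNorm_le_eLpNorm_of_exponent_le le_top (Lp.aestronglyMeasurable X))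

theorem coeFn_inclusionL2 (X : Lp ℝ ∞ P) : inclusionL2 P X =ᵐ[P] X :=
  MemLp.coeFn_toLp ((Lp.memLp X).mono_exponent le_top)

theorem inclusionL2_injective : Function.Injective (inclusionL2 P) := by
  intro X Y h
  refine Lp.ext ?_
  filter_upwards [coeFn_inclusionL2 X, coeFn_inclusionL2 Y] with ω h1 h2
  rw [← h1, ← h2, h]

/-- An L^2 limit is an almost sure limit along a subsequence, and the L^∞ bound `r` serves as
dominating constant; the dominating function in L^2 would not suffice. -/
theorem IsFatouClosed.isClosed_image {A : Set (Lp ℝ ∞ P)} (hA : IsFatouClosed A) {r : ℝ}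
    (hr : 0 ≤ r) : IsClosed (inclusionL2 P '' (A ∩ Metric.closedBall 0 r)) := by
  refine IsSeqClosed.isClosed fun Ys Y hYs h => ?_
  obtain ⟨φ, -, -, hlim⟩ := exists_subseq_dominated h
  choose Xs hXs hXY using hYs
  have hXs' : ∀ n, ∀ᵐ ω ∂P, |Xs n ω| ≤ r := by
    intro n
    filter_upwards [ae_abs_le_norm (Xs n)] with ω hω
    exact hω.trans (by simpa using (hXs n).2)
  have hlim' : ∀ᵐ ω ∂P, Tendsto (fun n => Xs (φ n) ω) atTop (𝓝 (Y ω)) := by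
    filter_upwards [hlim, ae_all_iff.2 fun n => coeFn_inclusionL2 (Xs n)] with ω h1 h2
    refine h1.congr fun n => ?_
    rw [← hXY, h2]
  have hYr : ∀ᵐ ω ∂P, |Y ω| ≤ r := by
    filter_upwards [hlim', ae_all_iff.2 hXs'] with ω h1 h2
    exact le_of_tendsto' h1.abs fun n => h2 _
  have hY : MemLp Y ∞ P := memLp_top_of_bound (Lp.aestronglyMeasurable Y) r hYr
  refine ⟨hY.toLp Y, ⟨hA (fun n => Xs (φ n)) _ (Lp.const ∞ P r) (fun n => (hXs _).1) ?_ ?_, ?_⟩, ?_⟩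
  · intro n
    filter_upwards [hXs' (φ n), Lp.coeFn_const ∞ P r] with ω h1 h2
    rwa [h2]
  · filter_upwards [hlim', hY.coeFn_toLp] with ω h1 h2
    rwa [h2]
  · rw [mem_closedBall_zero_iff]
    refine norm_le_of_ae_abs_le hr ?_
    filter_upwards [hYr, hY.coeFn_toLp] with ω h1 h2
    rwa [h2]
  · refine Lp.ext ?_
    filter_upwards [coeFn_inclusionL2 (hY.toLp Y), hY.coeFn_toLp] with ω h1 h2
    rw [h1, h2]

/-- A functional on `L^∞` which is continuous on bounded sets for the norm of `L^2` is order
continuous. -/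
theorem isOrderContinuous_of_continuousOn_bounded {f : Lp ℝ ∞ P →L[ℝ] ℝ}
    (hf : ∀ r ε : ℝ, 0 < ε → ∃ δ > 0, ∀ X, ‖X‖ ≤ r → ‖inclusionL2 P X‖ ≤ δ → |f X| ≤ ε) :
    IsOrderContinuous f := by
  intro Xs X G hG hX
  have hnorm : ∀ n, ‖Xs n - X‖ ≤ ‖G‖ + ‖X‖ := by
    intro n
    refine (norm_sub_le _ _).trans ?_
    gcongr
    refine Lp.norm_le_norm_of_ae_le ?_
    filter_upwards [hG n] with ω hω using hω.trans (le_abs_self _)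
  have hlim : Tendsto (fun n => inclusionL2 P (Xs n)) atTop (𝓝 (inclusionL2 P X)) := by
    refine tendsto_Lp_of_dominated (by simp) _ _ (inclusionL2 P G) (fun n => ?_) ?_
    · filter_upwards [hG n, coeFn_inclusionL2 (Xs n), coeFn_inclusionL2 G] with ω h1 h2 h3
      rwa [h2, h3]
    · filter_upwards [hX, ae_all_iff.2 fun n => coeFn_inclusionL2 (Xs n),
        coeFn_inclusionL2 X] with ω h1 h2 h3
      simpa only [h2, h3] using h1
  rw [Metric.tendsto_atTop']
  intro ε hε
  obtain ⟨δ, hδ, hfδ⟩ := hf (‖G‖ + ‖X‖) (ε / 2) (half_pos hε)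
  obtain ⟨N, hN⟩ := Metric.tendsto_atTop'.1 hlim δ hδ
  refine ⟨N, fun n hn => ?_⟩
  have h1 := hN n hn
  rw [dist_eq_norm, ← map_sub] at h1
  have h2 := hfδ _ (hnorm n) h1.le
  rw [Real.dist_eq, ← map_sub]
  linarith

end Top

/-! ### Separation by probability measures -/

section Separation

variable {Ω : Type*} [MeasurableSpace Ω] {P : Measure Ω} [IsProbabilityMeasure P] {p q : ℝ≥0∞}

theorem IsFatouClosed.preimage_add {Ω : Type*} [MeasurableSpace Ω] {P : Measure Ω} {p : ℝ≥0∞}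
    {A : Set (Lp ℝ p P)} (hA : IsFatouClosed A) (Y : Lp ℝ p P) :
    IsFatouClosed ((fun X => X + Y) ⁻¹' A) := by
  intro Xs X G hXs hG hX
  refine hA (fun n => Xs n + Y) (X + Y) (G + |Y|) hXs (fun n => ?_) ?_
  · filter_upwards [hG n, Lp.coeFn_add (Xs n) Y, Lp.coeFn_add G |Y|, Lp.coeFn_abs Y]
      with ω h1 h2 h3 h4
    rw [h2, h3, Pi.add_apply, Pi.add_apply, h4]
    exact (abs_add_le _ _).trans (by gcongr)
  · filter_upwards [hX, ae_all_iff.2 fun n => Lp.coeFn_add (Xs n) Y, Lp.coeFn_add X Y]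
      with ω h1 h2 h3
    simp_rw [h2, h3, Pi.add_apply]
    exact h1.add_const _

/-- Separation of a point from a Fatou closed convex set by an order continuous functional. -/
theorem IsFatouClosed.exists_orderContinuous_separating [Fact (1 ≤ p)] {A : Set (Lp ℝ p P)}
    (hA : IsFatouClosed A) (hconv : Convex ℝ A) {X : Lp ℝ p P} (hX : X ∉ A) :
    ∃ (f : Lp ℝ p P →L[ℝ] ℝ) (u : ℝ), IsOrderContinuous f ∧ f X < u ∧ ∀ Z ∈ A, u ≤ f Z := by
  by_cases hp : p = ∞
  · subst hp
    have hball : ∀ n : ℕ, IsClosed (inclusionL2 P '' Metric.closedBall 0 (n : ℝ)) := by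
      intro n
      have huniv : IsFatouClosed (Set.univ : Set (Lp ℝ ∞ P)) := fun _ _ _ _ _ _ => trivial
      simpa using huniv.isClosed_image n.cast_nonneg
    -- `A` is translated by `-X`, so that the point to separate becomes the origin.
    obtain ⟨f, u, hu, hfA, hf⟩ := exists_separating_of_isClosed_image (inclusionL2 P)
      inclusionL2_injective hball (hconv.affine_preimage
        (AffineMap.id ℝ (Lp ℝ ∞ P) + AffineMap.const ℝ (Lp ℝ ∞ P) X))
      (fun n => (hA.preimage_add X).isClosed_image n.cast_nonneg) (by simpa using hX)
    refine ⟨f, u + f X, isOrderContinuous_of_continuousOn_bounded hf, by linarith, fun Z hZ => ?_⟩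
    have := hfA (Z - X) (by simpa using hZ)
    rw [map_sub] at this
    linarith
  · obtain ⟨f, u, hfX, hfA⟩ := geometric_hahn_banach_point_closed hconv hA.isClosed hX
    refine ⟨f, u, fun Xs Y G hG hY => ?_, hfX, fun Z hZ => (hfA Z hZ).le⟩
    exact (f.continuous.tendsto Y).comp (tendsto_Lp_of_dominated hp Xs Y G hG hY)

/-- Separation of a point from a nonempty, convex, Fatou closed and upward closed set by the
expectation under a probability measure with density in `L^q`. -/
theorem IsFatouClosed.exists_dualMeasures_separating [Fact (1 ≤ p)] (hpq : p.HolderConjugate q)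
    {A : Set (Lp ℝ p P)} (hA : IsFatouClosed A) (hconv : Convex ℝ A) (hup : IsUpperSet A)
    (hne : A.Nonempty) {X : Lp ℝ p P} (hX : X ∉ A) :
    ∃ Q ∈ dualMeasures P q, ∃ u : ℝ, ∫ ω, X ω ∂Q < u ∧ ∀ Z ∈ A, u ≤ ∫ ω, Z ω ∂Q := by
  obtain ⟨f, u, hfc, hfX, hfA⟩ := hA.exists_orderContinuous_separating hconv hX
  obtain ⟨Z₀, hZ₀⟩ := hne
  -- A negative value `f Y` would drive `f (Z₀ + n • Y)` below `u`.
  have hpos : ∀ Y, 0 ≤ Y → 0 ≤ f Y := by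
    intro Y hY
    by_contra! hneg
    obtain ⟨n, hn⟩ := exists_nat_gt ((f Z₀ - u) / -f Y)
    rw [div_lt_iff₀ (by linarith)] at hn
    have h := hfA (Z₀ + n • Y)
      (hup (le_add_of_nonneg_right (nsmul_nonneg hY n)) hZ₀)
    rw [map_add, map_nsmul, nsmul_eq_mul] at h
    linarith
  -- If the total mass vanished, `f` would be zero and could not separate. Positivity allows
  -- normalization.
  have h1 : 0 < f (Lp.const p P 1) := by
    obtain ⟨μ, hμ, hμP, h⟩ := exists_measure_forall_integral_eq (f := f.toLinearMap) hpos hfc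
    have hμ1 : μ.real Set.univ = f (Lp.const p P 1) := by
      have := (h (Lp.const p P 1)).2
      rw [integral_congr_ae (hμP.ae_le (Lp.coeFn_const p P (1 : ℝ)))] at this
      simpa using this
    rw [← hμ1]
    refine lt_of_le_of_ne measureReal_nonneg fun h0 => ?_
    have hμ0 : μ = 0 := Measure.measure_univ_eq_zero.1 ((measureReal_eq_zero_iff).1 h0.symm)
    have hf0 : ∀ Y, f Y = 0 := fun Y => by
      have := (h Y).2
      rw [hμ0, integral_zero_measure] at this
      exact this.symm
    have h2 := hfA Z₀ hZ₀
    rw [hf0] at h2 hfX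
    linarith
  set c := f (Lp.const p P 1) with hc
  obtain ⟨Q, hQ, hQf⟩ := exists_mem_dualMeasures hpq (c⁻¹ • f)
    (fun Y hY => mul_nonneg (inv_nonneg.2 h1.le) (hpos Y hY))
    (fun Xs Y G hG hY => (hfc Xs Y G hG hY).const_mul c⁻¹) (inv_mul_cancel₀ h1.ne')
  refine ⟨Q, hQ, c⁻¹ * u, ?_, fun Z hZ => ?_⟩
  · rw [(hQf X).2]
    exact mul_lt_mul_of_pos_left hfX (inv_pos.2 h1)
  · rw [(hQf Z).2]
    exact mul_le_mul_of_nonneg_left (hfA Z hZ) (inv_nonneg.2 h1.le)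

end Separation

/-! ### Extended real arithmetic -/

theorem coe_sub_coe_add_le_iff (x y : ℝ) (a c : EReal) :
    (x : EReal) - (y + a) ≤ c ↔ ((x - y : ℝ) : EReal) - c ≤ a := by
  induction a with
  | bot => induction c with
    | bot => simp [-EReal.coe_sub]
    | coe c => simp [← EReal.coe_sub]
    | top => simp
  | coe a => induction c with
    | bot => simp [← EReal.coe_sub, ← EReal.coe_add]
    | coe c =>
      norm_cast
      constructor <;> intro h <;> linarith
    | top => simp
  | top => simp

theorem coe_sub_le_sub_coe_iff (a t : ℝ) (s c : EReal) :
    (a : EReal) - c ≤ s - t ↔ ((a + t : ℝ) : EReal) - s ≤ c := by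
  induction s with
  | bot => induction c with
    | bot => simp
    | coe c => simp [← EReal.coe_sub]
    | top => simp
  | coe s => induction c with
    | bot => simp [← EReal.coe_sub, -EReal.coe_add]
    | coe c =>
      norm_cast
      constructor <;> intro h <;> linarith
    | top => simp
  | top => simp

/-- Both sides have the same upper bounds. Every sum or difference has a real term, so ∞ - ∞ never
occurs. -/
theorem coe_sub_coe_add_iInf {ι : Sort*} (x y : ℝ) (s : ι → EReal) (t : ι → ℝ) :
    (x : EReal) - (y + ⨅ i, (s i - t i)) = ⨆ i, (((x - y + t i : ℝ) : EReal) - s i) :=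
  eq_of_forall_ge_iff fun c => by
    rw [coe_sub_coe_add_le_iff, le_iInf_iff, iSup_le_iff]
    exact forall_congr' fun i => coe_sub_le_sub_coe_iff _ _ _ _

/-! ### Dual representation of risk measures -/

section RiskMeasure

variable {Ω : Type*} [MeasurableSpace Ω] {P : Measure Ω} [IsProbabilityMeasure P] {p q : ℝ≥0∞}

theorem self_mem_dualMeasures : P ∈ dualMeasures P q := by
  refine ⟨inferInstance, Measure.AbsolutelyContinuous.rfl, ?_⟩
  refine (memLp_const (1 : ℝ)).ae_eq ?_
  filter_upwards [Measure.rnDeriv_self P] with ω hω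
  simp [hω]

theorem memLp_iSup_abs_of_dominated {Ω : Type*} [MeasurableSpace Ω] {P : Measure Ω} {p : ℝ≥0∞}
    {Xs : ℕ → Lp ℝ p P} {G : Lp ℝ p P} (hG : ∀ n, ∀ᵐ ω ∂P, |Xs n ω| ≤ G ω) :
    MemLp (fun ω => ⨆ n, |Xs n ω|) p P := by
  refine (Lp.memLp G).mono ?_ ?_
  · refine (Measurable.iSup fun n => ?_).aestronglyMeasurable
    exact (Lp.stronglyMeasurable (Xs n)).measurable.abs
  · filter_upwards [ae_all_iff.2 hG] with ω hω
    rw [Real.norm_of_nonneg (Real.iSup_nonneg fun n => abs_nonneg _)]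
    exact (ciSup_le hω).trans (le_abs_self _)

theorem isFatouClosed_acceptanceSet {Ω : Type*} [MeasurableSpace Ω] {P : Measure Ω} {p : ℝ≥0∞}
    {ρ : Lp ℝ p P → EReal} (h : HasFatouProperty P p ρ) : IsFatouClosed (acceptanceSet ρ) := by
  intro Xs X G hXs hG hX
  refine (h Xs X hX (memLp_iSup_abs_of_dominated hG)).trans ?_
  refine liminf_le_of_le (by isBoundedDefault) fun b hb => ?_
  obtain ⟨n, hn⟩ := hb.exists
  exact hn.trans (hXs n)

theorem convex_acceptanceSet {Ω : Type*} [MeasurableSpace Ω] {P : Measure Ω} {p : ℝ≥0∞}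
    {ρ : Lp ℝ p P → EReal} (h : IsConvex P p ρ) : Convex ℝ (acceptanceSet ρ) := by
  intro X hX Y hY a b ha hb hab
  obtain rfl : b = 1 - a := by linarith
  refine (h X Y a ha (by linarith)).trans (add_nonpos ?_ ?_)
  · exact mul_nonpos_of_nonneg_of_nonpos (EReal.coe_nonneg.2 ha) hX
  · exact mul_nonpos_of_nonneg_of_nonpos (EReal.coe_nonneg.2 hb) hY

theorem IsMonetary.isUpperSet_acceptanceSet {ρ : Lp ℝ p P → EReal} (h : IsMonetary P p ρ) :
    IsUpperSet (acceptanceSet ρ) := fun X Y hXY hX =>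
  (h.monotone Y X ((Lp.coeFn_le X Y).2 hXY)).trans hX

theorem IsMonetary.add_const_mem_acceptanceSet_iff {ρ : Lp ℝ p P → EReal} (h : IsMonetary P p ρ)
    (X : Lp ℝ p P) (m : ℝ) : X + Lp.const p P m ∈ acceptanceSet ρ ↔ ρ X ≤ m := by
  rw [acceptanceSet, Set.mem_ofPred_eq, h.cash_invariant, EReal.sub_nonpos]

theorem integral_neg_add_const (hpq : p.HolderConjugate q) {Q : Measure Ω}
    (hQ : Q ∈ dualMeasures P q) (X : Lp ℝ p P) (m : ℝ) :
    ∫ ω, -(X + Lp.const p P m) ω ∂Q = ∫ ω, -X ω ∂Q - m := by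
  have := hQ.1
  have hae : ∀ᵐ ω ∂Q, -(X + Lp.const p P m) ω = -X ω - m := by
    filter_upwards [hQ.2.1.ae_le (Lp.coeFn_add X (Lp.const p P m)),
      hQ.2.1.ae_le (Lp.coeFn_const p P m)] with ω h1 h2
    rw [h1, Pi.add_apply, h2, Function.const_apply]
    ring
  rw [integral_congr_ae hae,
    integral_sub (f := fun ω => -X ω) (integrable_of_mem_dualMeasures hpq hQ X).neg
      (integrable_const m)]
  simp

/-- The dual representation of a convex monetary risk measure with the Fatou property. -/
theorem IsMonetary.dual_representation (hp : 1 ≤ p) (hpq : p.HolderConjugate q)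
    {ρ : Lp ℝ p P → EReal} (hmon : IsMonetary P p ρ) (hconv : IsConvex P p ρ)
    (hfatou : HasFatouProperty P p ρ) (X : Lp ℝ p P) :
    ρ X = ⨆ Q ∈ dualMeasures P q, (((∫ ω, -X ω ∂Q : ℝ) : EReal) -
      ⨆ Z ∈ acceptanceSet ρ, ((∫ ω, -Z ω ∂Q : ℝ) : EReal)) := by
  have : Fact (1 ≤ p) := ⟨hp⟩
  apply le_antisymm
  · rcases (acceptanceSet ρ).eq_empty_or_nonempty with hA | hA
    -- With an empty acceptance set the inner supremum is `⊥`, so the single measure `P` already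
    -- gives `⊤`.
    · refine le_trans le_top (le_iSup₂_of_le P self_mem_dualMeasures ?_)
      simp [hA]
    refine EReal.ge_of_forall_gt_iff_ge.1 fun c hc => ?_
    have hcA : X + Lp.const p P c ∉ acceptanceSet ρ := by
      rw [hmon.add_const_mem_acceptanceSet_iff]
      exact hc.not_ge
    obtain ⟨Q, hQ, u, hu, huA⟩ :=
      (isFatouClosed_acceptanceSet hfatou).exists_dualMeasures_separating hpq
        (convex_acceptanceSet hconv) hmon.isUpperSet_acceptanceSet hA hcA
    refine le_iSup₂_of_le Q hQ ?_
    have h1 : (⨆ Z ∈ acceptanceSet ρ, ((∫ ω, -Z ω ∂Q : ℝ) : EReal)) ≤ ((-u : ℝ) : EReal) := by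
      refine iSup₂_le fun Z hZ => EReal.coe_le_coe ?_
      rw [integral_neg]
      exact neg_le_neg (huA Z hZ)
    refine le_trans ?_ (EReal.sub_le_sub le_rfl h1)
    have h2 := integral_neg_add_const hpq hQ X c
    rw [integral_neg] at h2
    rw [← EReal.coe_sub]
    exact EReal.coe_le_coe (by linarith)
  · refine iSup₂_le fun Q hQ => ?_
    refine EReal.le_of_forall_lt_iff_le.1 fun c hc => ?_
    -- For real `c > ρ X` the position `X + c` is acceptable, so the penalty is at least E_Q(-X) -
    -- c.
    have h1 := le_iSup₂_of_le (f := fun (Z : Lp ℝ p P) (_ : Z ∈ acceptanceSet ρ) =>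
      ((∫ ω, -Z ω ∂Q : ℝ) : EReal)) _
      ((hmon.add_const_mem_acceptanceSet_iff X c).2 hc.le) le_rfl
    rw [integral_neg_add_const hpq hQ] at h1
    refine (EReal.sub_le_sub le_rfl h1).trans ?_
    rw [← EReal.coe_sub, sub_sub_cancel]

end RiskMeasure

end RecoveryRisk

/-! ### The recovery risk measure -/

theorem propositionA1 {Ω : Type*} [MeasurableSpace Ω] (P : Measure Ω) [IsProbabilityMeasure P]
    (p q : ℝ≥0∞) (hp : 1 ≤ p) (hpq : p.HolderConjugate q)
    (ρ : Set.Icc (0 : ℝ) 1 → Lp ℝ p P → EReal)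
    (hanti : ∀ l₁ l₂ : Set.Icc (0 : ℝ) 1, l₁ ≤ l₂ → ∀ X : Lp ℝ p P, ρ l₂ X ≤ ρ l₁ X)
    (hmon : ∀ l, RecoveryRisk.IsMonetary P p (ρ l))
    (hconv : ∀ l, RecoveryRisk.IsConvex P p (ρ l))
    (hfatou : ∀ l, RecoveryRisk.HasFatouProperty P p (ρ l))
    (X Y : Lp ℝ p P) :
    RecoveryRisk.recoveryRisk ρ X Y =
      ⨆ Q ∈ RecoveryRisk.dualMeasures P q,
        (((∫ ω, -X ω ∂Q : ℝ) : EReal) - RecoveryRisk.penalty ρ Y Q) := by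
  have hrep : ∀ l, ρ l (X + (1 - (l : ℝ)) • Y) =
      ⨆ Q ∈ RecoveryRisk.dualMeasures P q,
        (((∫ ω, -X ω ∂Q - ∫ ω, Y ω ∂Q + (l : ℝ) * ∫ ω, Y ω ∂Q : ℝ) : EReal) -
          ⨆ Z ∈ RecoveryRisk.acceptanceSet (ρ l), ((∫ ω, -Z ω ∂Q : ℝ) : EReal)) := by
    intro l
    rw [(hmon l).dual_representation hp hpq (hconv l) (hfatou l)]
    refine biSup_congr fun Q hQ => ?_
    congr 2
    have hae : ∀ᵐ ω ∂Q, -(X + (1 - (l : ℝ)) • Y) ω = -X ω - (1 - (l : ℝ)) * Y ω := by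
      filter_upwards [hQ.2.1.ae_le (Lp.coeFn_add X ((1 - (l : ℝ)) • Y)),
        hQ.2.1.ae_le (Lp.coeFn_smul (1 - (l : ℝ)) Y)] with ω h1 h2
      rw [h1, Pi.add_apply, h2, Pi.smul_apply, smul_eq_mul]
      ring
    rw [integral_congr_ae hae,
      integral_sub (f := fun ω => -X ω) (RecoveryRisk.integrable_of_mem_dualMeasures hpq hQ X).neg
        ((RecoveryRisk.integrable_of_mem_dualMeasures hpq hQ Y).const_mul _),
      integral_const_mul]
    ring
  rw [RecoveryRisk.recoveryRisk]
  simp_rw [hrep, RecoveryRisk.penalty, RecoveryRisk.coe_sub_coe_add_iInf]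
  rw [iSup_comm]
  exact iSup_congr fun Q => iSup_comm
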